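/- **Setting.** Let $\mathcal X,\mathcal U$ be finite sets and let $M_i=(\mathcal X,\mathcal U,P_i,r_i)$, $i=0,1$, be two Markov decision processes, where $P_i(x,u)$ is the law of the next state. Both are ergodic: every policy $\pi$ (a map assigning to each state a probability distribution on $\mathcal U$) induces an irreducible, hence positive recurrent, Markov chain on $\mathcal X$, with a unique stationary distribution $\mu_i^{\pi}$. Assume $P_1(x,u)\ll P_0(x,u)$ for all $(x,u)$. Let $\pi_0,\pi_1$ be policies. The observations are $Y_t=(X_t,U_t)$, $t\ge1$. Under $\mathbb P_\nu$ (change point $\nu\ge1$), the conditional density of $Y_t$ given $Y_1,\dots,Y_{t-1}$ is $f_0$ for $t<\nu$ and $f_1$ for $t\ge\nu$, where $$f_i\big((x,u)\mid Y_1,\dots,Y_{t-1}\big)=P_i(x\mid X_{t-1},U_{t-1})\,\pi_i(u\mid x)\quad(t\ge2),$$ and at $t=1$, $f_0(x,u)=\mu_0^{\pi_0}(x)\pi_0(u\mid x)$, $f_1(x,u)=\rho(x)\pi_1(u\mid x)$, with $\rho$ an arbitrary distribution on $\mathcal X$ (for instance $\rho=\mu_1^{\pi_1}$). Let $\mathcal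 F_t=\sigma(Y_1,\dots,Y_t)$ and $$Z_t=\ln\frac{f_1(Y_t\mid Y_1,\dots,Y_{t-1})}{f_0(Y_t\mid Y_1,\dots,Y_{t-1})},$$ which is $+\infty$ where $f_0$ vanishes and $f_1$ does not. *Lai's assumption* with constant $I\in\mathbb R$: for every $\nu\ge1$, $n^{-1}\sum_{t=\nu}^{\nu+n}Z_t\to I$ $\mathbb P_\nu$-a.s., and for every $\delta>0$, $$\lim_{n\to\infty}\ \sup_{\nu\ge1}\ \operatorname{ess\,sup}\ \mathbb P_\nu\Big(\max_{0\le t\le n}\sum_{i=\nu}^{\nu+t}Z_i\ge I(1+\delta)n\ \Big|\ \mathcal F_{\nu-1}\Big)=0 .$$ The constant is unique if it exists. The inverse privacy level $I_F=I_F(\pi_0,\pi_1)$ is this constant $I$ if Lai's assumption holds for some $I$, and $I_F=\infty$ otherwise. Let $D(P,Q)=\mathbb E_{\omega\sim P}[\ln (P(\omega)/Q(\omega))]$ be the Kullback-Leibler divergence, and put $$J=\mathbb E_{x\sim\mu_1^{\pi_1},\,u\sim\pi_1(x)}\big[D(P_1(x,u),P_0(x,u))\big]+\mathbb E_{x\sim\mu_1^{\pi_1}}\big[D(\pi_1(x),\pi_0(x))\big].$$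 **Theorem.** (i) Suppose $\pi_1(x)\ll\pi_0(x)$ for every $x\in\operatorname{supp}(\mu_1^{\pi_1})$. Then $J<\infty$, and for every $\nu\ge1$ we have $n^{-1}\sum_{t=\nu}^{\nu+n}Z_t\to J$ $\mathbb P_\nu$-a.s. If moreover the change is not void, i.e. for some $x\in\operatorname{supp}(\mu_1^{\pi_1})$ either $\pi_1(x)\ne\pi_0(x)$ or $P_1(x,u)\neq P_0(x,u)$ for some $u\in\operatorname{supp}(\pi_1(x))$, then the observations satisfy Lai's assumption with constant $J$, and $I_F=J$. (ii) If $\pi_1(x)\not\ll\pi_0(x)$ for some $x\in\operatorname{supp}(\mu_1^{\pi_1})$, then Lai's assumption holds for no constant $I$, and $I_F=\infty$. -/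

import Mathlib

open MeasureTheory ProbabilityTheory Filter
open scoped Topology ENNReal

/-! ## Quickest change detection

The observation at time `t = k + 1` (`k = 0, 1, 2, …`) is the coordinate with index `k` of a
trajectory `ω : ℕ → 𝒴`.  Accordingly the change point `ν ≥ 1` is represented by the index
`ν - 1 : ℕ`, and the supremum over all change points is a supremum over `ℕ`. -/

/-- The conditional laws (densities with respect to counting measure) of a sequence of observations
in a discrete space: `init` is the law of the first observation, and `step n h` is the conditional
law of the observation with index `n + 1` given that those with indices `0, …, n` are equal
to `h`. -/
structure ObsLaw (𝒴 : Type*) where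
  init : PMF 𝒴
  step : (n : ℕ) → (Finset.Iic n → 𝒴) → PMF 𝒴

namespace ObsLaw

variable {𝒴 : Type*}

/-- The conditional density of the observation with index `k` given the previous ones, evaluated
along the trajectory `ω`. -/
noncomputable def density (f : ObsLaw 𝒴) : ℕ → (ℕ → 𝒴) → ℝ≥0∞
  | 0, ω => f.init (ω 0)
  | n + 1, ω => f.step n (fun i => ω i) (ω (n + 1))

/-- Conditional law `f₀` strictly before the change index `ν`, and `f₁` from `ν` on. -/
def switch (f₀ f₁ : ObsLaw 𝒴) (ν : ℕ) : ObsLaw 𝒴 where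
  init := if 0 < ν then f₀.init else f₁.init
  step n h := if n + 1 < ν then f₀.step n h else f₁.step n h

/-- The log-likelihood ratio `Z_k = ln (f₁(Y_k | past) / f₀(Y_k | past))`, which is `⊤` where
`f₀` vanishes and `f₁` does not. -/
noncomputable def llRatio (f₀ f₁ : ObsLaw 𝒴) (k : ℕ) (ω : ℕ → 𝒴) : EReal :=
  ENNReal.log (f₁.density k ω / f₀.density k ω)

section Law

variable [Finite 𝒴] [MeasurableSpace 𝒴] [MeasurableSingletonClass 𝒴]

/-- `step n` as a Markov kernel. -/
noncomputable def kernel (f : ObsLaw 𝒴) (n : ℕ) : Kernel (Finset.Iic n → 𝒴) 𝒴 :=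
  Kernel.ofFunOfCountable fun h => (f.step n h).toMeasure

instance (f : ObsLaw 𝒴) (n : ℕ) : IsMarkovKernel (f.kernel n) :=
  ⟨fun h => inferInstanceAs (IsProbabilityMeasure (f.step n h).toMeasure)⟩

/-- The law of the whole trajectory (Ionescu-Tulcea). -/
noncomputable def law (f : ObsLaw 𝒴) : Measure (ℕ → 𝒴) :=
  Kernel.trajMeasure (X := fun _ => 𝒴) f.init.toMeasure f.kernel

/-- `ℙ_ν`: the law of the observations when the change happens at index `ν`. -/
noncomputable def changeLaw (f₀ f₁ : ObsLaw 𝒴) (ν : ℕ) : Measure (ℕ → 𝒴) :=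
  (switch f₀ f₁ ν).law

/-- The σ-algebra generated by the observations with index `< ν`. -/
abbrev past (𝒴 : Type*) [MeasurableSpace 𝒴] (ν : ℕ) : MeasurableSpace (ℕ → 𝒴) :=
  ⨆ i : ℕ, ⨆ _ : i < ν, MeasurableSpace.comap (fun ω : ℕ → 𝒴 => ω i) inferInstance

/-- The event `max_{t ≤ n} ∑_{i = ν}^{ν + t} Z_i ≥ c`. -/
def overshoot (f₀ f₁ : ObsLaw 𝒴) (ν n : ℕ) (c : ℝ) : Set (ℕ → 𝒴) :=
  {ω | (c : EReal) ≤ (Finset.range (n + 1)).sup fun t =>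
    ∑ i ∈ Finset.range (t + 1), llRatio f₀ f₁ (ν + i) ω}

/-- For every change point `ν`, the averages `n⁻¹ ∑_{t = ν}^{ν + n} Z_t` converge `ℙ_ν`-almost
surely to `I`. -/
def AverageConverges (f₀ f₁ : ObsLaw 𝒴) (I : ℝ) : Prop :=
  ∀ ν : ℕ, ∀ᵐ ω ∂(changeLaw f₀ f₁ ν),
    Tendsto (fun n : ℕ => (∑ i ∈ Finset.range (n + 1), llRatio f₀ f₁ (ν + i) ω) / (n : EReal))
      atTop (𝓝 (I : EReal))

/-- Lai's assumption with the constant `I`: the averages of the log-likelihood ratios after the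
change converge almost surely to `I`, and for every `δ > 0`,
`sup_ν ess sup ℙ_ν (max_{t ≤ n} ∑_{i = ν}^{ν + t} Z_i ≥ I (1 + δ) n | past of ν) → 0`. -/
def LaiAssumption (f₀ f₁ : ObsLaw 𝒴) (I : ℝ) : Prop :=
  AverageConverges f₀ f₁ I ∧
  ∀ δ : ℝ, 0 < δ →
    Tendsto (fun n : ℕ => ⨆ ν : ℕ, essSup
      (fun ω => ENNReal.ofReal
        (((changeLaw f₀ f₁ ν)⟦overshoot f₀ f₁ ν n (I * (1 + δ) * n) | past 𝒴 ν⟧) ω))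
      (changeLaw f₀ f₁ ν))
    atTop (𝓝 0)

open Classical in
/-- The inverse of the privacy level: the constant `I` of Lai's assumption if the assumption holds
for some constant (which is then unique, being an almost sure limit), and `∞` otherwise. -/
noncomputable def invPrivacy (f₀ f₁ : ObsLaw 𝒴) : EReal :=
  if h : ∃ I : ℝ, LaiAssumption f₀ f₁ I then (h.choose : EReal) else ⊤

end Law

end ObsLaw

/-! ## Markov decision processes -/

/-- A Markov decision process with state space `X` and action space `U`: `P x u` is the law of
the next state and `r` is the reward. -/
structure MDP (X U : Type*) where
  P : X → U → PMF X
  r : X → U → ℝ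

namespace MDP

variable {X U : Type*}

/-- One step of the Markov chain on `X` induced by the policy `π`. -/
noncomputable def chain (M : MDP X U) (π : X → PMF U) (x : X) : PMF X :=
  (π x).bind (M.P x)

/-- The transition matrix of the chain induced by `π`. -/
noncomputable def transition (M : MDP X U) (π : X → PMF U) : Matrix X X ℝ :=
  Matrix.of fun x y => (M.chain π x y).toReal

/-- `μ` is a stationary distribution of the chain induced by `π`. -/
def IsStationary (M : MDP X U) (π : X → PMF U) (μ : PMF X) : Prop :=
  μ.bind (M.chain π) = μ

/-- A finite MDP is ergodic if every policy induces an irreducible chain.  (On a finite state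
space such a chain is positive recurrent, and has exactly one stationary distribution.) -/
def IsErgodic [Finite X] [Finite U] (M : MDP X U) : Prop :=
  ∀ π : X → PMF U, (M.transition π).IsIrreducible

/-- The conditional laws of `Y_t = (X_t, U_t)` under the policy `π`, if `X_1` has law `ρ`. -/
noncomputable def fullObs (M : MDP X U) (π : X → PMF U) (ρ : PMF X) : ObsLaw (X × U) where
  init := ρ.bind fun x => (π x).map (Prod.mk x)
  step n h :=
    let y := h ⟨n, Finset.mem_Iic.2 le_rfl⟩
    (M.P y.1 y.2).bind fun x => (π x).map (Prod.mk x)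

/-- `I_F`, the inverse privacy level in the full-information case: `M₀` and `π₀`, started from
`μ₀`, are in force before the change, and `M₁` and `π₁` from the change on.  If the change
happens at the very first time, then `X_1` has law `ρ`. -/
noncomputable def invPrivacyFull [Finite X] [Finite U]
    [MeasurableSpace X] [MeasurableSingletonClass X]
    [MeasurableSpace U] [MeasurableSingletonClass U]
    (M₀ M₁ : MDP X U) (π₀ π₁ : X → PMF U) (μ₀ ρ : PMF X) : EReal :=
  ObsLaw.invPrivacy (M₀.fullObs π₀ μ₀) (M₁.fullObs π₁ ρ)

/-- `𝔼_{x ∼ μ, u ∼ π₁(x)} D(P₁(x,u), P₀(x,u)) + 𝔼_{x ∼ μ} D(π₁(x), π₀(x))`. -/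
noncomputable def fullInfo [Fintype X] [Fintype U] [MeasurableSpace X] [MeasurableSpace U]
    (M₀ M₁ : MDP X U) (π₀ π₁ : X → PMF U) (μ : PMF X) : ℝ≥0∞ :=
  (∑ x, μ x * ∑ u, π₁ x u *
      InformationTheory.klDiv (M₁.P x u).toMeasure (M₀.P x u).toMeasure) +
    ∑ x, μ x * InformationTheory.klDiv (π₁ x).toMeasure (π₀ x).toMeasure

end MDP

/-!
The observations after the change form a homogeneous Markov chain on state-action pairs, and the
log-likelihood ratio at any later time is a function of the last transition. Write `J` for the
stationary mean of the relative entropy of the next observation given the present one. By the chain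
rule for relative entropy (`MDP.sum_obsKernel_mul_log`) and stationarity, `J` is `MDP.fullInfo`
(`MDP.toReal_fullInfo`).

In the absolutely continuous case, let `h` solve the Poisson equation of the chain with the
conditional mean of the log-likelihood ratio on the right-hand side. The equation is solvable
because the state chain is irreducible (`Matrix.IsIrreducible.exists_poisson`,
`MDP.exists_poisson_obsKernel`). Then the log-likelihood ratios add up to a drift `J t`, a
martingale with bounded increments and a bounded remainder (`ObsLaw.exists_decomposition`). The
martingale obeys an exponential tail bound, uniformly in the change point and conditionally on the
past (`ObsLaw.measure_transitionSum_ge_le`). With the Borel-Cantelli lemma this yields the almost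
sure convergence of the averages (`ObsLaw.averageConverges_of_decomposition`). If the change is not
void, then `J > 0`, an overshoot of level `J (1 + δ) n` forces the martingale above a multiple
of `n`, and a union bound over the times `t ≤ n` yields the second half of Lai's assumption
(`ObsLaw.laiAssumption_of_decomposition`).

If absolute continuity fails at some state, then a state-action pair that is impossible before the
change is reached after it with positive probability (`MDP.exists_law_eq_ne_zero`). From then on
the sums of the log-likelihood ratios are infinite, so that no finite limit is possible
(`ObsLaw.not_averageConverges_of_density_eq_zero`).
-/

/-! ### The law of the observations -/

theorem PMF.sum_toReal {α : Type*} [Fintype α] (p : PMF α) : ∑ a, (p a).toReal = 1 := by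
  rw [← ENNReal.toReal_sum fun a _ => p.apply_ne_top a, ← tsum_fintype (L := .unconditional _),
    p.tsum_coe, ENNReal.toReal_one]

theorem exists_abs_le_of_finite {α : Type*} [Finite α] (φ : α → ℝ) : ∃ K, ∀ a, |φ a| ≤ K := by
  obtain ⟨K, hK⟩ := (Set.finite_range fun a => |φ a|).bddAbove
  exact ⟨K, fun a => hK ⟨a, rfl⟩⟩

namespace ObsLaw

variable {𝒴 : Type*} [Fintype 𝒴] [MeasurableSpace 𝒴] [MeasurableSingletonClass 𝒴]

instance (f : ObsLaw 𝒴) : IsProbabilityMeasure f.law :=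
  inferInstanceAs (IsProbabilityMeasure (Kernel.trajMeasure (X := fun _ => 𝒴) _ _))

theorem lintegral_pmf (p : PMF 𝒴) (φ : 𝒴 → ℝ≥0∞) :
    ∫⁻ y, φ y ∂p.toMeasure = ∑ y, p y * φ y := by
  rw [lintegral_fintype]
  refine Finset.sum_congr rfl fun y _ => ?_
  rw [PMF.toMeasure_apply_singleton _ _ (measurableSet_singleton y), mul_comm]

/-- The observation with index `n + 1` is averaged over its conditional law given the previous
ones. -/
theorem lintegral_step (f : ObsLaw 𝒴) (n : ℕ) (φ : (Finset.Iic n → 𝒴) → 𝒴 → ℝ≥0∞) :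
    ∫⁻ ω, φ (fun i => ω i) (ω (n + 1)) ∂f.law =
      ∫⁻ ω, ∑ y, f.step n (fun i => ω i) y * φ (fun i => ω i) y ∂f.law := by
  have key := Kernel.map_frestrictLe_trajMeasure_compProd_eq_map_trajMeasure
    (X := fun _ => 𝒴) (μ₀ := f.init.toMeasure) (κ := f.kernel) (a := n)
  have h1 : ∫⁻ p, φ p.1 p.2 ∂(f.law.map
      (fun x => (Preorder.frestrictLe (π := fun _ => 𝒴) n x, x (n + 1)))) =
      ∫⁻ ω, φ (fun i => ω i) (ω (n + 1)) ∂f.law := by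
    rw [lintegral_map (.of_discrete) (by fun_prop)]
    rfl
  rw [← h1, law, ← key, Measure.lintegral_compProd .of_discrete,
    lintegral_map .of_discrete (by fun_prop)]
  refine lintegral_congr fun ω => ?_
  exact lintegral_pmf _ _

theorem law_map_zero (f : ObsLaw 𝒴) : f.law.map (fun ω => ω 0) = f.init.toMeasure := by
  have h1 : f.law.map (Preorder.frestrictLe (π := fun _ => 𝒴) 0) =
      f.init.toMeasure.map (MeasurableEquiv.piUnique fun _ : Finset.Iic 0 => 𝒴).symm := by
    rw [law, Kernel.trajMeasure, Measure.map_comp _ _ (by fun_prop), Kernel.traj_map_frestrictLe,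
      Kernel.partialTraj_self, Measure.id_comp]
  have h2 : (fun ω : ℕ → 𝒴 => ω 0) = (MeasurableEquiv.piUnique fun _ : Finset.Iic 0 => 𝒴) ∘
      Preorder.frestrictLe (π := fun _ => 𝒴) 0 := rfl
  rw [h2, ← Measure.map_map (by fun_prop) (by fun_prop), h1,
    Measure.map_map (by fun_prop) (by fun_prop), MeasurableEquiv.self_comp_symm, Measure.map_id]

theorem ae_step (f : ObsLaw 𝒴) (n : ℕ) {p : (Finset.Iic n → 𝒴) → 𝒴 → Prop}
    (hp : ∀ h y, f.step n h y ≠ 0 → p h y) :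
    ∀ᵐ ω ∂f.law, p (fun i => ω i) (ω (n + 1)) := by
  classical
  have h0 := f.lintegral_step n fun h y => if p h y then 0 else 1
  have h1 : ∀ h : Finset.Iic n → 𝒴, ∑ y, f.step n h y * (if p h y then (0 : ℝ≥0∞) else 1) = 0 := by
    intro h
    refine Finset.sum_eq_zero fun y _ => ?_
    by_cases hy : f.step n h y = 0
    · simp [hy]
    · simp [hp h y hy]
  simp only [h1, lintegral_zero] at h0
  have hm : Measurable fun ω : ℕ → 𝒴 =>
      if p (fun i : Finset.Iic n => ω i) (ω (n + 1)) then (0 : ℝ≥0∞) else 1 := by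
    have : Measurable fun q : (Finset.Iic n → 𝒴) × 𝒴 => if p q.1 q.2 then (0 : ℝ≥0∞) else 1 :=
      .of_discrete
    exact this.comp (f := fun ω : ℕ → 𝒴 => ((fun i : Finset.Iic n => ω i), ω (n + 1)))
      (by fun_prop)
  filter_upwards [(lintegral_eq_zero_iff hm).1 h0] with ω hω
  by_contra hc
  simp [hc] at hω

theorem ae_init (f : ObsLaw 𝒴) {p : 𝒴 → Prop} (hp : ∀ y, f.init y ≠ 0 → p y) :
    ∀ᵐ ω ∂f.law, p (ω 0) := by
  refine ae_of_ae_map (f := fun ω : ℕ → 𝒴 => ω 0) (measurable_pi_apply 0).aemeasurable ?_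
  rw [law_map_zero, ae_iff,
    PMF.toMeasure_apply_eq_zero_iff _ (Set.Finite.measurableSet (Set.toFinite _)),
    Set.disjoint_left]
  intro y hy hy'
  exact hy' (hp y hy)

/-- Almost surely no observation has conditional density zero. -/
theorem ae_density_ne_zero (f : ObsLaw 𝒴) : ∀ᵐ ω ∂f.law, ∀ k, f.density k ω ≠ 0 := by
  refine ae_all_iff.2 fun k => ?_
  cases k with
  | zero => exact f.ae_init fun y hy => hy
  | succ n => exact f.ae_step n (p := fun h y => f.step n h y ≠ 0) fun h y hy => hy

end ObsLaw

/-! ### Exponential bounds and the strong law for Markov chains -/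

namespace ObsLaw

variable {𝒴 : Type*} [Fintype 𝒴] [MeasurableSpace 𝒴] [MeasurableSingletonClass 𝒴]

/-- From index `ν` on, the observations form a time-homogeneous Markov chain with kernel `Q`. -/
def IsMarkovFrom {𝒴 : Type*} (f : ObsLaw 𝒴) (Q : 𝒴 → PMF 𝒴) (ν : ℕ) : Prop :=
  ∀ n, ν ≤ n → ∀ h, f.step n h = Q (h ⟨n, Finset.mem_Iic.2 le_rfl⟩)

/-- The trajectory that repeats the last of finitely many observations forever. -/
def extend {𝒴 : Type*} {n : ℕ} (h : Finset.Iic n → 𝒴) (i : ℕ) : 𝒴 :=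
  h ⟨min i n, Finset.mem_Iic.2 (min_le_right i n)⟩

theorem extend_restrict {𝒴 : Type*} {n i : ℕ} (ω : ℕ → 𝒴) (hi : i ≤ n) :
    extend (fun j : Finset.Iic n => ω j) i = ω i := by
  simp [extend, hi]

theorem measurable_of_dependsOn {β : Type*} [MeasurableSpace β] {g : (ℕ → 𝒴) → β} {n : ℕ}
    (hg : DependsOn g (Set.Iic n)) : Measurable g := by
  have h : g = (fun h : Finset.Iic n → 𝒴 => g (extend h)) ∘ fun ω i => ω i := by
    funext ω
    exact hg fun i hi => (extend_restrict ω hi).symm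
  rw [h]
  exact Measurable.comp .of_discrete (by fun_prop)

theorem measurableSet_of_dependsOn {A : Set (ℕ → 𝒴)} {n : ℕ}
    (hA : DependsOn (· ∈ A) (Set.Iic n)) : MeasurableSet A :=
  measurableSet_setOfPred.2 (measurable_of_dependsOn hA)

/-- The Markov property in integrated form: `g` depends on the observations up to the index `n`
only, and `ψ` on the transition that follows. -/
theorem lintegral_markov {f : ObsLaw 𝒴} {Q : 𝒴 → PMF 𝒴} {ν n : ℕ} (hf : f.IsMarkovFrom Q ν)
    (hn : ν ≤ n) {g : (ℕ → 𝒴) → ℝ≥0∞} (hg : DependsOn g (Set.Iic n)) (ψ : 𝒴 → 𝒴 → ℝ≥0∞) :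
    ∫⁻ ω, g ω * ψ (ω n) (ω (n + 1)) ∂f.law =
      ∫⁻ ω, g ω * ∑ y, Q (ω n) y * ψ (ω n) y ∂f.law := by
  have hgω (ω : ℕ → 𝒴) : g (extend fun j : Finset.Iic n => ω j) = g ω :=
    hg fun i hi => extend_restrict ω hi
  have h := f.lintegral_step n fun h y =>
    g (extend h) * ψ (h ⟨n, Finset.mem_Iic.2 le_rfl⟩) y
  simp only [hgω, hf n hn] at h
  rw [h]
  refine lintegral_congr fun ω => ?_
  rw [Finset.mul_sum]
  exact Finset.sum_congr rfl fun y _ => by ring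

/-- The sum of `W` over the `t` transitions of the trajectory that follow the index `ν`. -/
def transitionSum {𝒴 : Type*} (W : 𝒴 → 𝒴 → ℝ) (ν t : ℕ) (ω : ℕ → 𝒴) : ℝ :=
  ∑ i ∈ Finset.range t, W (ω (ν + i)) (ω (ν + i + 1))

theorem dependsOn_transitionSum {𝒴 : Type*} (W : 𝒴 → 𝒴 → ℝ) (ν t : ℕ) :
    DependsOn (transitionSum W ν t) (Set.Iic (ν + t)) := by
  intro ω ω' h
  refine Finset.sum_congr rfl fun i hi => ?_
  have hi := Finset.mem_range.1 hi
  rw [h (ν + i) (Set.mem_Iic.2 (by omega)), h (ν + i + 1) (Set.mem_Iic.2 (by omega))]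

theorem measurable_transitionSum (W : 𝒴 → 𝒴 → ℝ) (ν t : ℕ) :
    Measurable (transitionSum W ν t) :=
  measurable_of_dependsOn (dependsOn_transitionSum W ν t)

/-- A centred random variable bounded by `C` has moment generating function at most
`exp (θ² C²)` at `θ` as long as `|θ| C ≤ 1`. -/
theorem sum_mul_exp_le {𝒴 : Type*} [Fintype 𝒴] (p : PMF 𝒴) {w : 𝒴 → ℝ} {C θ : ℝ}
    (hw : ∀ y, |w y| ≤ C)
    (h0 : ∑ y, (p y).toReal * w y = 0) (hθ : |θ| * C ≤ 1) :
    ∑ y, p y * ENNReal.ofReal (Real.exp (θ * w y)) ≤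
      ENNReal.ofReal (Real.exp (θ ^ 2 * C ^ 2)) := by
  have h2 : ∑ y, p y * ENNReal.ofReal (Real.exp (θ * w y)) =
      ENNReal.ofReal (∑ y, (p y).toReal * Real.exp (θ * w y)) := by
    rw [ENNReal.ofReal_sum_of_nonneg fun y _ => by positivity]
    refine Finset.sum_congr rfl fun y _ => ?_
    rw [ENNReal.ofReal_mul ENNReal.toReal_nonneg, ENNReal.ofReal_toReal (p.apply_ne_top y)]
  rw [h2]
  refine ENNReal.ofReal_le_ofReal ?_
  calc ∑ y, (p y).toReal * Real.exp (θ * w y)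
      ≤ ∑ y, (p y).toReal * (1 + θ * w y + θ ^ 2 * C ^ 2) := by
        refine Finset.sum_le_sum fun y _ => mul_le_mul_of_nonneg_left ?_ ENNReal.toReal_nonneg
        have h3 : |θ * w y| ≤ |θ| * C := by
          rw [abs_mul]
          exact mul_le_mul_of_nonneg_left (hw y) (abs_nonneg θ)
        have h4 := (abs_le.1 (Real.abs_exp_sub_one_sub_id_le (h3.trans hθ))).2
        have h5 : (θ * w y) ^ 2 ≤ θ ^ 2 * C ^ 2 := by
          rw [← sq_abs (θ * w y), ← sq_abs θ, ← mul_pow]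
          exact pow_le_pow_left₀ (abs_nonneg _) h3 2
        linarith
    _ = (∑ y, (p y).toReal) * (1 + θ ^ 2 * C ^ 2) + θ * ∑ y, (p y).toReal * w y := by
        rw [Finset.sum_mul, Finset.mul_sum, ← Finset.sum_add_distrib]
        exact Finset.sum_congr rfl fun y _ => by ring
    _ = θ ^ 2 * C ^ 2 + 1 := by rw [p.sum_toReal, h0]; ring
    _ ≤ Real.exp (θ ^ 2 * C ^ 2) := Real.add_one_le_exp _

section Concentration

variable {f : ObsLaw 𝒴} {Q : 𝒴 → PMF 𝒴} {ν : ℕ} {W : 𝒴 → 𝒴 → ℝ} {C : ℝ}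

theorem setLIntegral_exp_transitionSum_le (hf : f.IsMarkovFrom Q ν)
    (hW0 : ∀ y, ∑ y', (Q y y').toReal * W y y' = 0) (hWC : ∀ y y', |W y y'| ≤ C)
    {B : Set (ℕ → 𝒴)} (hB : DependsOn (· ∈ B) (Set.Iic ν)) {θ : ℝ} (hθ : |θ| * C ≤ 1) (t : ℕ) :
    ∫⁻ ω in B, ENNReal.ofReal (Real.exp (θ * transitionSum W ν t ω)) ∂f.law ≤
      ENNReal.ofReal (Real.exp (θ ^ 2 * C ^ 2 * t)) * f.law B := by
  classical
  rw [← lintegral_indicator (measurableSet_of_dependsOn hB)]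
  induction t with
  | zero => simp [transitionSum, lintegral_indicator (measurableSet_of_dependsOn hB)]
  | succ t ih =>
    let g : (ℕ → 𝒴) → ℝ≥0∞ :=
      B.indicator fun ω => ENNReal.ofReal (Real.exp (θ * transitionSum W ν t ω))
    have hg : DependsOn g (Set.Iic (ν + t)) := by
      intro ω ω' h
      have h1 : ω ∈ B ↔ ω' ∈ B := iff_of_eq (hB fun i hi =>
        h i (Set.mem_Iic.2 ((Set.mem_Iic.1 hi).trans (Nat.le_add_right ν t))))
      simp only [g, Set.indicator_apply, h1, dependsOn_transitionSum W ν t h]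
    have hstep : ∀ ω, B.indicator
        (fun ω => ENNReal.ofReal (Real.exp (θ * transitionSum W ν (t + 1) ω))) ω =
        g ω * ENNReal.ofReal (Real.exp (θ * W (ω (ν + t)) (ω (ν + t + 1)))) := by
      intro ω
      by_cases hω : ω ∈ B
      · simp only [g, Set.indicator_of_mem hω, transitionSum, Finset.sum_range_succ]
        rw [← ENNReal.ofReal_mul (Real.exp_nonneg _), ← Real.exp_add, mul_add]
      · simp [g, Set.indicator_of_notMem hω]
    simp only [hstep]
    rw [lintegral_markov hf (Nat.le_add_right ν t) hg
      fun y y' => ENNReal.ofReal (Real.exp (θ * W y y'))]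
    calc ∫⁻ ω, g ω * ∑ y, Q (ω (ν + t)) y *
          ENNReal.ofReal (Real.exp (θ * W (ω (ν + t)) y)) ∂f.law
        ≤ ∫⁻ ω, g ω * ENNReal.ofReal (Real.exp (θ ^ 2 * C ^ 2)) ∂f.law :=
          lintegral_mono fun ω => mul_le_mul_right
            (sum_mul_exp_le (Q (ω (ν + t))) (hWC _) (hW0 _) hθ) _
      _ = (∫⁻ ω, g ω ∂f.law) * ENNReal.ofReal (Real.exp (θ ^ 2 * C ^ 2)) :=
          lintegral_mul_const _ (measurable_of_dependsOn hg)
      _ ≤ ENNReal.ofReal (Real.exp (θ ^ 2 * C ^ 2 * t)) * f.law B *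
            ENNReal.ofReal (Real.exp (θ ^ 2 * C ^ 2)) := mul_le_mul_left ih _
      _ = _ := by
          rw [mul_right_comm, ← ENNReal.ofReal_mul (Real.exp_nonneg _), ← Real.exp_add]
          congr 3
          push_cast
          ring

/-- An Azuma-type bound whose constants depend neither on `ν`, nor on the law of the past, nor on
the event `B` of the past on which it is conditioned. -/
theorem measure_transitionSum_ge_le (hf : f.IsMarkovFrom Q ν)
    (hW0 : ∀ y, ∑ y', (Q y y').toReal * W y y' = 0) (hWC : ∀ y y', |W y y'| ≤ C)
    {B : Set (ℕ → 𝒴)} (hB : DependsOn (· ∈ B) (Set.Iic ν)) {ε : ℝ} (hε : 0 < ε) (hεC : ε ≤ 2 * C)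
    {t n : ℕ} (htn : t ≤ n) :
    f.law (B ∩ {ω | ε * n ≤ transitionSum W ν t ω}) ≤
      ENNReal.ofReal (Real.exp (-(ε ^ 2 / (4 * C ^ 2)) * n)) * f.law B := by
  have hC : 0 < C := by linarith
  -- the minimizer of `θ² C² - θ ε`
  set θ : ℝ := ε / (2 * C ^ 2) with hθ
  have hθ0 : 0 < θ := by positivity
  have hθC : |θ| * C ≤ 1 := by
    rw [abs_of_pos hθ0, hθ, show ε / (2 * C ^ 2) * C = ε / (2 * C) by field_simp]
    exact (div_le_one (by positivity)).2 hεC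
  have hm : Measurable fun ω => ENNReal.ofReal (Real.exp (θ * transitionSum W ν t ω)) := by
    have := measurable_transitionSum W ν t
    fun_prop
  have h1 := mul_meas_ge_le_lintegral₀ (μ := f.law.restrict B) hm.aemeasurable
    (ENNReal.ofReal (Real.exp (θ * (ε * n))))
  have h2 := h1.trans (setLIntegral_exp_transitionSum_le hf hW0 hWC hB hθC t)
  have hsub : B ∩ {ω | ε * n ≤ transitionSum W ν t ω} ⊆
      {ω | ENNReal.ofReal (Real.exp (θ * (ε * n))) ≤
        ENNReal.ofReal (Real.exp (θ * transitionSum W ν t ω))} ∩ B := fun ω hω =>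
    ⟨ENNReal.ofReal_le_ofReal (Real.exp_le_exp.2 (mul_le_mul_of_nonneg_left hω.2 hθ0.le)), hω.1⟩
  rw [Measure.restrict_apply (measurableSet_le measurable_const hm)] at h2
  have h3 : ENNReal.ofReal (Real.exp (θ * (ε * n))) *
      f.law (B ∩ {ω | ε * n ≤ transitionSum W ν t ω}) ≤
      ENNReal.ofReal (Real.exp (θ ^ 2 * C ^ 2 * t)) * f.law B :=
    (mul_le_mul_right (measure_mono hsub) _).trans h2
  calc f.law (B ∩ {ω | ε * n ≤ transitionSum W ν t ω})
      = ENNReal.ofReal (Real.exp (-(θ * (ε * n)))) * (ENNReal.ofReal (Real.exp (θ * (ε * n))) *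
          f.law (B ∩ {ω | ε * n ≤ transitionSum W ν t ω})) := by
        rw [← mul_assoc, ← ENNReal.ofReal_mul (Real.exp_nonneg _), ← Real.exp_add]
        simp
    _ ≤ ENNReal.ofReal (Real.exp (-(θ * (ε * n)))) *
          (ENNReal.ofReal (Real.exp (θ ^ 2 * C ^ 2 * t)) * f.law B) := mul_le_mul_right h3 _
    _ = ENNReal.ofReal (Real.exp (-(θ * (ε * n)) + θ ^ 2 * C ^ 2 * t)) * f.law B := by
        rw [← mul_assoc, ← ENNReal.ofReal_mul (Real.exp_nonneg _), ← Real.exp_add]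
    _ ≤ _ := by
        refine mul_le_mul_left (ENNReal.ofReal_le_ofReal (Real.exp_le_exp.2 ?_)) _
        have h4 : θ ^ 2 * C ^ 2 * t ≤ θ ^ 2 * C ^ 2 * n := by
          have : (t : ℝ) ≤ n := by exact_mod_cast htn
          gcongr
        have h5 : -(θ * (ε * n)) + θ ^ 2 * C ^ 2 * n = -(ε ^ 2 / (4 * C ^ 2)) * n := by
          rw [hθ]
          field_simp
          ring
        linarith

/-- The strong law of large numbers for bounded martingale differences `W` of a finite Markov
chain. -/
theorem ae_tendsto_transitionSum_div (hf : f.IsMarkovFrom Q ν)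
    (hW0 : ∀ y, ∑ y', (Q y y').toReal * W y y' = 0) :
    ∀ᵐ ω ∂f.law, Tendsto (fun n : ℕ => transitionSum W ν n ω / n) atTop (𝓝 0) := by
  obtain ⟨C, hC⟩ : ∃ C, ∀ y y', |W y y'| ≤ C := by
    obtain ⟨C, hC⟩ := exists_abs_le_of_finite fun p : 𝒴 × 𝒴 => W p.1 p.2
    exact ⟨C, fun y y' => hC (y, y')⟩
  -- it suffices to bound the upper tails: the lower ones are those of `-W`
  have upper : ∀ V : 𝒴 → 𝒴 → ℝ, (∀ y, ∑ y', (Q y y').toReal * V y y' = 0) →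
      (∀ y y', |V y y'| ≤ C) → ∀ ε : ℝ, 0 < ε →
      ∀ᵐ ω ∂f.law, ∀ᶠ n : ℕ in atTop, transitionSum V ν n ω < ε * n := by
    intro V hV0 hVC ε hε
    -- the bound is enlarged to meet the condition `ε ≤ 2 C'` of the tail estimate
    set C' : ℝ := max C ε with hC'
    have hC'0 : 0 < C' := lt_max_of_lt_right hε
    have hbound (n : ℕ) : f.law {ω | ε * n ≤ transitionSum V ν n ω} ≤
        ENNReal.ofReal (Real.exp (-(ε ^ 2 / (4 * C' ^ 2))) ^ n) := by
      have h := measure_transitionSum_ge_le (t := n) (n := n) (C := C') (B := Set.univ) hf hV0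
        (fun y y' => (hVC y y').trans (le_max_left _ _)) (fun _ _ _ => rfl) hε
        (by linarith [le_max_right C ε]) le_rfl
      rw [← Real.exp_nat_mul, mul_comm (n : ℝ)]
      simpa using h
    have hsum : ∑' n : ℕ, f.law {ω | ε * n ≤ transitionSum V ν n ω} ≠ ∞ := by
      refine ne_top_of_le_ne_top ?_ (ENNReal.tsum_le_tsum hbound)
      refine Summable.tsum_ofReal_ne_top (summable_geometric_of_lt_one (Real.exp_nonneg _) ?_)
      rw [← Real.exp_zero]
      exact Real.exp_lt_exp.2 (neg_lt_zero.2 (by positivity))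
    filter_upwards [ae_eventually_notMem hsum] with ω hω
    filter_upwards [hω] with n hn
    exact not_le.1 hn
  have hneg : ∀ n ω, transitionSum (fun y y' => -W y y') ν n ω = -transitionSum W ν n ω := by
    intro n ω
    simp [transitionSum]
  have h1 := ae_all_iff.2 fun m : ℕ => upper W hW0 hC (1 / (m + 1)) Nat.one_div_pos_of_nat
  have h2 := ae_all_iff.2 fun m : ℕ => upper (fun y y' => -W y y')
    (fun y => by simp [hW0 y]) (by simpa using hC) (1 / (m + 1)) Nat.one_div_pos_of_nat
  filter_upwards [h1, h2] with ω hω1 hω2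
  rw [Metric.tendsto_atTop']
  intro ε hε
  obtain ⟨m, hm⟩ := exists_nat_one_div_lt hε
  obtain ⟨N, hN⟩ := eventually_atTop.1 ((hω1 m).and ((hω2 m).and (eventually_gt_atTop 0)))
  refine ⟨N, fun n hn => ?_⟩
  obtain ⟨ha, hb, hn0⟩ := hN n hn.le
  have hn0 : (0 : ℝ) < n := by exact_mod_cast hn0
  rw [hneg] at hb
  rw [Real.dist_eq, sub_zero, abs_div, abs_of_pos hn0, div_lt_iff₀ hn0, abs_lt]
  have := mul_lt_mul_of_pos_right hm hn0
  constructor <;> linarith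

end Concentration

end ObsLaw

/-! ### Lai's assumption from a martingale decomposition -/

/-- A bound on the conditional probability of `A` follows from a bound on `μ (B ∩ A)` for all
conditioning events `B`. -/
theorem condExp_indicator_le {Ω : Type*} {m m₀ : MeasurableSpace Ω} (hm : m ≤ m₀)
    {μ : Measure Ω} [IsFiniteMeasure μ] {A : Set Ω} (hA : MeasurableSet A) {c : ℝ≥0∞} (hc : c ≠ ∞)
    (h : ∀ B, MeasurableSet[m] B → μ (B ∩ A) ≤ c * μ B) :
    μ⟦A | m⟧ ≤ᵐ[μ] fun _ => c.toReal := by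
  have hint : Integrable (A.indicator fun _ => (1 : ℝ)) μ := (integrable_const 1).indicator hA
  refine ae_le_of_ae_le_trim (hm := hm) (ae_le_of_forall_setIntegral_le
    (integrable_condExp.trim hm stronglyMeasurable_condExp) (integrable_const _) fun B hB _ => ?_)
  rw [← setIntegral_trim hm stronglyMeasurable_condExp hB, setIntegral_condExp hm hint hB,
    setIntegral_indicator hA, setIntegral_const, setIntegral_const, smul_eq_mul, mul_one,
    smul_eq_mul, mul_comm, Measure.real, Measure.real, trim_measurableSet_eq hm hB,
    ← ENNReal.toReal_mul]
  exact ENNReal.toReal_mono (ENNReal.mul_ne_top hc (measure_ne_top μ B)) (h B hB)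

namespace ObsLaw

variable {𝒴 : Type*} [Fintype 𝒴] [MeasurableSpace 𝒴] [MeasurableSingletonClass 𝒴]

theorem past_le {𝒴 : Type*} [MeasurableSpace 𝒴] (ν : ℕ) : past 𝒴 ν ≤ MeasurableSpace.pi :=
  iSup₂_le fun i _ => (measurable_pi_apply i).comap_le

theorem dependsOn_of_measurableSet_past {𝒴 : Type*} [MeasurableSpace 𝒴] {ν : ℕ} {B : Set (ℕ → 𝒴)}
    (hB : MeasurableSet[past 𝒴 ν] B) : DependsOn (· ∈ B) (Set.Iic ν) := by
  have h : past 𝒴 ν ≤ MeasurableSpace.comap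
      (fun (ω : ℕ → 𝒴) (i : Finset.Iic ν) => ω i) MeasurableSpace.pi := by
    refine iSup₂_le fun i hi => ?_
    have : (fun ω : ℕ → 𝒴 => ω i) = (fun h : Finset.Iic ν → 𝒴 => h ⟨i, Finset.mem_Iic.2 hi.le⟩) ∘
        fun ω i => ω i := rfl
    rw [this, ← MeasurableSpace.comap_comp]
    exact MeasurableSpace.comap_mono (measurable_pi_apply _).comap_le
  obtain ⟨s, -, rfl⟩ := h B hB
  intro ω ω' hω
  have : (fun i : Finset.Iic ν => ω i) = fun i : Finset.Iic ν => ω' i :=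
    funext fun i => hω i (Set.mem_Iic.2 (Finset.mem_Iic.1 i.2))
  simp only [Set.mem_preimage, this]

instance (f₀ f₁ : ObsLaw 𝒴) (ν : ℕ) : IsProbabilityMeasure (changeLaw f₀ f₁ ν) :=
  inferInstanceAs (IsProbabilityMeasure (switch f₀ f₁ ν).law)

theorem IsMarkovFrom.switch {𝒴 : Type*} {f₁ : ObsLaw 𝒴} {Q : 𝒴 → PMF 𝒴} (h : f₁.IsMarkovFrom Q 0)
    (f₀ : ObsLaw 𝒴) (ν : ℕ) : (ObsLaw.switch f₀ f₁ ν).IsMarkovFrom Q ν := by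
  intro n hn k
  have : ¬ n + 1 < ν := by omega
  simp only [ObsLaw.switch, this, if_false]
  exact h n (Nat.zero_le n) k

section Decomposition

variable {f₀ f₁ : ObsLaw 𝒴} {Q : 𝒴 → PMF 𝒴} {W : 𝒴 → 𝒴 → ℝ} {J K : ℝ}

/-- If the log-likelihood ratios after the change add up to a drift `J`, a martingale and a
bounded remainder, then their averages converge to `J`. -/
theorem averageConverges_of_decomposition (hf : f₁.IsMarkovFrom Q 0)
    (hW0 : ∀ y, ∑ y', (Q y y').toReal * W y y' = 0)
    (hdec : ∀ ν, ∀ᵐ ω ∂(changeLaw f₀ f₁ ν), ∀ t : ℕ, ∃ R : ℝ, |R| ≤ K ∧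
      ∑ i ∈ Finset.range (t + 1), llRatio f₀ f₁ (ν + i) ω =
        ((J * t + transitionSum W ν t ω + R : ℝ) : EReal)) :
    AverageConverges f₀ f₁ J := by
  intro ν
  filter_upwards [hdec ν, ae_tendsto_transitionSum_div (hf.switch f₀ ν) hW0] with ω hω hS
  choose R hR hsum using hω
  have hR0 : Tendsto (fun n : ℕ => R n / n) atTop (𝓝 0) := by
    refine squeeze_zero_norm (a := fun n : ℕ => K / n) (fun n => ?_)
      (tendsto_const_div_atTop_nhds_zero_nat K)
    rw [Real.norm_eq_abs, abs_div, Nat.abs_cast]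
    exact div_le_div_of_nonneg_right (hR n) n.cast_nonneg
  have hlim : Tendsto (fun n : ℕ => J + transitionSum W ν n ω / n + R n / n) atTop (𝓝 J) := by
    simpa using (hS.const_add J).add hR0
  refine ((continuous_coe_real_ereal.tendsto J).comp hlim).congr' ?_
  filter_upwards [eventually_gt_atTop 0] with n hn
  have hn0 : (n : ℝ) ≠ 0 := by exact_mod_cast hn.ne'
  rw [hsum n, Function.comp_apply, show (n : EReal) = ((n : ℝ) : EReal) by simp, ← EReal.coe_div]
  congr 1
  field_simp

/-- With a positive drift `J`, the decomposition yields Lai's assumption: the overshoot forces the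
martingale above a multiple of `n`, which a union bound over `t ≤ n` makes exponentially
unlikely. -/
theorem laiAssumption_of_decomposition (hf : f₁.IsMarkovFrom Q 0) (hJ : 0 < J)
    (hW0 : ∀ y, ∑ y', (Q y y').toReal * W y y' = 0)
    (hdec : ∀ ν, ∀ᵐ ω ∂(changeLaw f₀ f₁ ν), ∀ t : ℕ, ∃ R : ℝ, |R| ≤ K ∧
      ∑ i ∈ Finset.range (t + 1), llRatio f₀ f₁ (ν + i) ω =
        ((J * t + transitionSum W ν t ω + R : ℝ) : EReal)) :
    LaiAssumption f₀ f₁ J := by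
  refine ⟨averageConverges_of_decomposition hf hW0 hdec, fun δ hδ => ?_⟩
  -- half of the excess `J δ` absorbs the remainder, the other half is left to the martingale
  set ε : ℝ := J * δ / 2 with hε
  have hε0 : 0 < ε := by positivity
  obtain ⟨C, hC, hεC⟩ : ∃ C : ℝ, (∀ y y', |W y y'| ≤ C) ∧ ε ≤ 2 * C := by
    obtain ⟨C, hC⟩ := exists_abs_le_of_finite fun p : 𝒴 × 𝒴 => W p.1 p.2
    refine ⟨max C ε, fun y y' => (hC (y, y')).trans (le_max_left _ _), ?_⟩
    linarith [le_max_right C ε]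
  set r : ℝ := Real.exp (-(ε ^ 2 / (4 * C ^ 2))) with hr
  have hC0 : 0 < C := by linarith
  have hr1 : r < 1 := by
    rw [hr, ← Real.exp_zero]
    exact Real.exp_lt_exp.2 (neg_lt_zero.2 (by positivity))
  have hr0 : 0 ≤ r := Real.exp_nonneg _
  have hbound : ∀ᶠ n : ℕ in atTop, ∀ ν, ∀ᵐ ω ∂(changeLaw f₀ f₁ ν),
      ((changeLaw f₀ f₁ ν)⟦overshoot f₀ f₁ ν n (J * (1 + δ) * n) | past 𝒴 ν⟧) ω ≤
        ((n : ℝ) + 1) * r ^ n := by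
    filter_upwards [(tendsto_natCast_atTop_atTop (R := ℝ)).eventually_ge_atTop (K / ε)] with n hn ν
    have hKn : K ≤ ε * n := by rwa [div_le_iff₀' hε0] at hn
    let A : Set (ℕ → 𝒴) := ⋃ t ∈ Finset.range (n + 1), {ω | ε * n ≤ transitionSum W ν t ω}
    have hA : MeasurableSet A := Finset.measurableSet_biUnion _ fun t _ =>
      measurableSet_le measurable_const (measurable_transitionSum W ν t)
    have hsub : (overshoot f₀ f₁ ν n (J * (1 + δ) * n)).indicator (fun _ => (1 : ℝ))
        ≤ᵐ[changeLaw f₀ f₁ ν] A.indicator fun _ => (1 : ℝ) := by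
      filter_upwards [hdec ν] with ω hω
      by_cases h : ω ∈ overshoot f₀ f₁ ν n (J * (1 + δ) * n)
      · suffices ω ∈ A by simp [this, h]
        rw [overshoot, Set.mem_ofPred_eq, Finset.le_sup_iff (EReal.bot_lt_coe _)] at h
        obtain ⟨t, ht, h⟩ := h
        obtain ⟨R, hR, hsum⟩ := hω t
        rw [hsum, EReal.coe_le_coe_iff] at h
        refine Set.mem_biUnion ht ?_
        have htn : (t : ℝ) ≤ n := by exact_mod_cast Nat.lt_succ_iff.1 (Finset.mem_range.1 ht)
        have h1 := mul_le_mul_of_nonneg_left htn hJ.le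
        have h2 := (abs_le.1 hR).2
        change ε * n ≤ transitionSum W ν t ω
        have h3 : J * (1 + δ) * n = J * n + 2 * (ε * n) := by rw [hε]; ring
        linarith
      · simpa [h] using Set.indicator_nonneg (fun _ _ => zero_le_one) ω
    have hnn : 0 ≤ ((n : ℝ) + 1) * r ^ n := by positivity
    have hcond : (changeLaw f₀ f₁ ν)⟦A | past 𝒴 ν⟧ ≤ᵐ[changeLaw f₀ f₁ ν]
        fun _ => (ENNReal.ofReal (((n : ℝ) + 1) * r ^ n)).toReal := by
      refine condExp_indicator_le (past_le ν) hA ENNReal.ofReal_ne_top fun B hB => ?_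
      have hB' := dependsOn_of_measurableSet_past hB
      simp only [A, Set.inter_iUnion₂]
      refine (measure_biUnion_finset_le _ _).trans ?_
      refine (Finset.sum_le_sum fun t ht => measure_transitionSum_ge_le (hf.switch f₀ ν) hW0 hC hB'
        hε0 hεC (Nat.lt_succ_iff.1 (Finset.mem_range.1 ht))).trans_eq ?_
      rw [Finset.sum_const, Finset.card_range, nsmul_eq_mul, ← mul_assoc,
        ENNReal.ofReal_mul (by positivity), hr, ← Real.exp_nat_mul, mul_comm (n : ℝ) (-_)]
      congr 2
      rw [ENNReal.ofReal_add n.cast_nonneg zero_le_one]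
      simp
    rw [ENNReal.toReal_ofReal hnn] at hcond
    -- a conditional expectation is zero by convention if the function is not integrable
    by_cases hint : Integrable ((overshoot f₀ f₁ ν n (J * (1 + δ) * n)).indicator
        (fun _ => (1 : ℝ))) (changeLaw f₀ f₁ ν)
    · exact (condExp_mono hint ((integrable_const _).indicator hA) hsub).trans hcond
    · rw [condExp_of_not_integrable hint]
      exact ae_of_all _ fun _ => hnn
  have hlim : Tendsto (fun n : ℕ => ENNReal.ofReal (((n : ℝ) + 1) * r ^ n)) atTop (𝓝 0) := by
    rw [← ENNReal.ofReal_zero]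
    refine ENNReal.tendsto_ofReal ?_
    simpa [add_mul] using (tendsto_self_mul_const_pow_of_lt_one hr0 hr1).add
      (tendsto_pow_atTop_nhds_zero_of_lt_one hr0 hr1)
  refine tendsto_of_tendsto_of_tendsto_of_le_of_le' tendsto_const_nhds hlim
    (Eventually.of_forall fun _ => zero_le) ?_
  filter_upwards [hbound] with n hn
  refine iSup_le fun ν => essSup_le_of_ae_le _ ?_
  filter_upwards [hn ν] with ω hω
  exact ENNReal.ofReal_le_ofReal hω

theorem invPrivacy_eq_of_laiAssumption (h : LaiAssumption f₀ f₁ J) :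
    invPrivacy f₀ f₁ = (J : EReal) := by
  have hex : ∃ I : ℝ, LaiAssumption f₀ f₁ I := ⟨J, h⟩
  rw [invPrivacy, dif_pos hex]
  obtain ⟨ω, h1, h2⟩ := ((hex.choose_spec.1 0).and (h.1 0)).exists
  exact tendsto_nhds_unique h1 h2

/-- A single observation that is impossible before the change makes the averages of the
log-likelihood ratios infinite, so a positive chance of it excludes Lai's assumption. -/
theorem not_averageConverges_of_density_eq_zero
    (h : ∃ k, ∃ᵐ ω ∂(changeLaw f₀ f₁ 0), f₀.density k ω = 0) (I : ℝ) :
    ¬ AverageConverges f₀ f₁ I := by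
  intro hI
  obtain ⟨k, hk⟩ := h
  have hsw : switch f₀ f₁ 0 = f₁ := by simp [switch]
  have hne : ∀ᵐ ω ∂(changeLaw f₀ f₁ 0), ∀ k, f₁.density k ω ≠ 0 := by
    rw [changeLaw, hsw]
    exact f₁.ae_density_ne_zero
  obtain ⟨ω, hω0, hω1, hω2⟩ := (hk.and_eventually (hne.and (hI 0))).exists
  have hle (i : ℕ) : f₀.density i ω ≠ ∞ := by cases i <;> exact PMF.apply_ne_top _ _
  have hbot (i : ℕ) : llRatio f₀ f₁ i ω ≠ ⊥ := by
    rw [llRatio, Ne, ENNReal.log_eq_bot_iff, ENNReal.div_eq_zero_iff]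
    exact not_or.2 ⟨hω1 i, hle i⟩
  have htop : llRatio f₀ f₁ k ω = ⊤ := by
    rw [llRatio, hω0, ENNReal.div_zero (hω1 k), ENNReal.log_top]
  have hsum (s : Finset ℕ) : ∑ i ∈ s, llRatio f₀ f₁ (0 + i) ω ≠ ⊥ := by
    classical
    induction s using Finset.induction_on with
    | empty => simp
    | insert a s ha ih =>
      rw [Finset.sum_insert ha]
      exact fun hc => (EReal.add_eq_bot_iff.1 hc).elim (by simpa using hbot a) ih
  refine EReal.coe_ne_top I (tendsto_nhds_unique hω2 (tendsto_const_nhds.congr' ?_))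
  filter_upwards [eventually_ge_atTop (k + 1)] with n hn
  rw [← Finset.add_sum_erase _ _ (Finset.mem_range.2 (show k < n + 1 by omega)), zero_add, htop,
    EReal.top_add_of_ne_bot (hsum _), EReal.top_div_of_pos_ne_top]
  · exact_mod_cast (by omega : 0 < n)
  · exact EReal.natCast_ne_top n

end Decomposition

end ObsLaw

/-! ### The Poisson equation of an irreducible chain -/

/-- A nonempty set of states that no positive transition leaves is the whole state space. -/
theorem Matrix.IsIrreducible.mem_of_closed {n : Type*} {A : Matrix n n ℝ} (hA : A.IsIrreducible)
    {S : Set n} (hne : S.Nonempty) (hS : ∀ x ∈ S, ∀ y, 0 < A x y → y ∈ S) (y : n) : y ∈ S := by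
  let : Quiver n := A.toQuiver
  obtain ⟨x, hx⟩ := hne
  obtain ⟨p, -⟩ := hA.connected x y
  induction p with
  | nil => exact hx
  | cons p e ih => exact hS _ ih _ e.down

/-- Harmonic functions of an irreducible stochastic matrix are constant (maximum principle). -/
theorem Matrix.IsIrreducible.eq_of_harmonic {n : Type*} [Fintype n] {A : Matrix n n ℝ}
    (hA : A.IsIrreducible) (h1 : ∀ x, ∑ y, A x y = 1) {v : n → ℝ}
    (hv : ∀ x, v x = ∑ y, A x y * v y) (x y : n) : v x = v y := by
  have : Nonempty n := ⟨x⟩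
  obtain ⟨x₀, hx₀⟩ := Finite.exists_max v
  have hmax (y : n) : y ∈ {x | v x = v x₀} := by
    refine hA.mem_of_closed (S := {x | v x = v x₀}) ⟨x₀, rfl⟩
      (fun x (hx : v x = v x₀) y hxy => ?_) y
    have hsum : ∑ y, A x y * (v x₀ - v y) = 0 := by
      simp only [mul_sub, Finset.sum_sub_distrib, ← Finset.sum_mul, h1, ← hv, hx]
      ring
    have h0 := (Finset.sum_eq_zero_iff_of_nonneg fun y _ =>
      mul_nonneg (hA.nonneg x y) (sub_nonneg.2 (hx₀ y))).1 hsum y (Finset.mem_univ y)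
    exact (sub_eq_zero.1 ((mul_eq_zero.1 h0).resolve_left hxy.ne')).symm
  exact (hmax x).trans (hmax y).symm

/-- Solvability of the Poisson equation of an irreducible stochastic matrix `A` with stationary
distribution `μ`: the kernel of `1 - A` consists of constants, so that its range has codimension at
most one, and the range is contained in the hyperplane of the functions with `μ`-mean zero. -/
theorem Matrix.IsIrreducible.exists_poisson {n : Type*} [Fintype n] {A : Matrix n n ℝ}
    (hA : A.IsIrreducible) (h1 : ∀ x, ∑ y, A x y = 1) {μ : n → ℝ} (hμ1 : ∑ x, μ x = 1)
    (hμ : ∀ y, ∑ x, μ x * A x y = μ y) {a : n → ℝ} (ha : ∑ x, μ x * a x = 0) :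
    ∃ h : n → ℝ, ∀ x, h x = a x + ∑ y, A x y * h y := by
  have hne : Nonempty n := by
    by_contra hn
    rw [not_nonempty_iff] at hn
    simp at hμ1
  let T : (n → ℝ) →ₗ[ℝ] (n → ℝ) := LinearMap.id - A.mulVecLin
  have hT (v : n → ℝ) (x : n) : T v x = v x - ∑ y, A x y * v y := rfl
  let φ : (n → ℝ) →ₗ[ℝ] ℝ := ∑ x, μ x • LinearMap.proj x
  have hφ (v : n → ℝ) : φ v = ∑ x, μ x * v x := by simp [φ]
  have hle : LinearMap.range T ≤ LinearMap.ker φ := by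
    rintro _ ⟨v, rfl⟩
    rw [LinearMap.mem_ker, hφ]
    simp only [hT, mul_sub, Finset.sum_sub_distrib, Finset.mul_sum]
    rw [Finset.sum_comm]
    simp only [← mul_assoc, ← Finset.sum_mul, hμ, sub_self]
  have hker : LinearMap.ker T ≤ Submodule.span ℝ {fun _ => (1 : ℝ)} := by
    intro v hv
    rw [LinearMap.mem_ker] at hv
    have hharm (x : n) : v x = ∑ y, A x y * v y := sub_eq_zero.1 (congrFun hv x)
    obtain ⟨x₀⟩ := hne
    refine Submodule.mem_span_singleton.2 ⟨v x₀, ?_⟩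
    funext x
    simpa using hA.eq_of_harmonic h1 hharm x₀ x
  have hker1 : Module.finrank ℝ (LinearMap.ker T) ≤ 1 :=
    (Submodule.finrank_mono hker).trans ((finrank_span_le_card _).trans_eq (by simp))
  have hφsurj : LinearMap.range φ = ⊤ := by
    refine LinearMap.range_eq_top.2 fun c => ⟨fun _ => c, ?_⟩
    rw [hφ, ← Finset.sum_mul, hμ1, one_mul]
  have hT' := T.finrank_range_add_finrank_ker
  have hφ' := φ.finrank_range_add_finrank_ker
  rw [hφsurj, finrank_top, Module.finrank_self] at hφ'
  have heq := Submodule.eq_of_le_of_finrank_le hle (by omega)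
  obtain ⟨h, hh⟩ : a ∈ LinearMap.range T := by rw [heq, LinearMap.mem_ker, hφ, ha]
  refine ⟨h, fun x => ?_⟩
  rw [← hh, hT]
  ring

/-! ### Relative entropy on a finite space -/

namespace PMF

variable {α : Type*} [Fintype α] [MeasurableSpace α] [MeasurableSingletonClass α]

theorem toMeasure_absolutelyContinuous_iff {α : Type*} [MeasurableSpace α]
    [MeasurableSingletonClass α] (p q : PMF α) :
    p.toMeasure ≪ q.toMeasure ↔ ∀ a, p a ≠ 0 → q a ≠ 0 := by
  constructor
  · intro h a hp hq
    have := @h {a}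
    rw [toMeasure_apply_singleton _ _ (measurableSet_singleton a),
      toMeasure_apply_singleton _ _ (measurableSet_singleton a)] at this
    exact hp (this hq)
  · intro h
    refine Measure.AbsolutelyContinuous.mk fun s hs => ?_
    rw [toMeasure_apply_eq_zero_iff _ hs, toMeasure_apply_eq_zero_iff _ hs]
    exact fun hd => hd.mono_left fun a ha => h a ha

theorem klDiv_toMeasure_ne_top {p q : PMF α} (h : p.toMeasure ≪ q.toMeasure) :
    InformationTheory.klDiv p.toMeasure q.toMeasure ≠ ∞ :=
  InformationTheory.klDiv_ne_top h .of_finite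

/-- Relative entropy of finite distributions as a sum. Junk values of the logarithm occur only
where `p` vanishes. -/
theorem toReal_klDiv_toMeasure {p q : PMF α} (h : p.toMeasure ≪ q.toMeasure) :
    (InformationTheory.klDiv p.toMeasure q.toMeasure).toReal =
      ∑ a, (p a).toReal * Real.log (p a / q a).toReal := by
  have hpq := (toMeasure_absolutelyContinuous_iff p q).1 h
  have hd : p.toMeasure = q.toMeasure.withDensity fun a => p a / q a := by
    refine Measure.ext_of_singleton fun a => ?_
    rw [withDensity_apply _ (measurableSet_singleton a), lintegral_singleton,
      toMeasure_apply_singleton _ _ (measurableSet_singleton a),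
      toMeasure_apply_singleton _ _ (measurableSet_singleton a)]
    by_cases hq : q a = 0
    · have hp : p a = 0 := by
        by_contra hp
        exact hpq a hp hq
      simp [hp]
    · rw [ENNReal.div_mul_cancel hq (q.apply_ne_top a)]
  have hrn : p.toMeasure.rnDeriv q.toMeasure =ᵐ[p.toMeasure] fun a => p a / q a := by
    refine h.ae_le ?_
    have := Measure.rnDeriv_withDensity q.toMeasure (f := fun a => p a / q a) .of_discrete
    rwa [← hd] at this
  rw [InformationTheory.toReal_klDiv_of_measure_eq h (by simp)]
  refine Eq.trans ?_ (PMF.integral_eq_sum p fun a => Real.log (p a / q a).toReal)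
  refine integral_congr_ae ?_
  filter_upwards [hrn] with a ha
  rw [llr, ha]

end PMF

/-! ### Log-likelihood ratios of Markovian observations -/

namespace ObsLaw

variable {𝒴 : Type*} [Fintype 𝒴] [MeasurableSpace 𝒴] [MeasurableSingletonClass 𝒴]

theorem density_switch {𝒴 : Type*} (f₀ f₁ : ObsLaw 𝒴) {ν k : ℕ} (hk : ν ≤ k) (ω : ℕ → 𝒴) :
    (switch f₀ f₁ ν).density k ω = f₁.density k ω := by
  cases k with
  | zero => simp [density, switch, Nat.le_zero.1 hk]
  | succ n => simp [density, switch, Nat.not_lt.2 hk]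

theorem IsMarkovFrom.density_succ {𝒴 : Type*} {f : ObsLaw 𝒴} {Q : 𝒴 → PMF 𝒴}
    (hf : f.IsMarkovFrom Q 0) (n : ℕ) (ω : ℕ → 𝒴) : f.density (n + 1) ω = Q (ω n) (ω (n + 1)) := by
  rw [density, hf n (Nat.zero_le n)]

/-- The log-likelihood ratios after the change add up to a drift `J`, a sum over transitions and a
bounded remainder, which consists of the boundary terms of `h` and of the ratio at the change point
(the latter is singled out because at index `0` it belongs to the initial laws, not to a
transition). The summands have conditional mean zero exactly if `h` solves the Poisson equation of
the log-likelihood ratio. -/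
theorem exists_decomposition {f₀ f₁ : ObsLaw 𝒴} {Q₀ Q₁ : 𝒴 → PMF 𝒴}
    (hf₀ : f₀.IsMarkovFrom Q₀ 0) (hf₁ : f₁.IsMarkovFrom Q₁ 0)
    (hinit : ∀ y, f₁.init y ≠ 0 → f₀.init y ≠ 0) (hQ : ∀ y y', Q₁ y y' ≠ 0 → Q₀ y y' ≠ 0)
    (J : ℝ) (h : 𝒴 → ℝ) :
    ∃ K : ℝ, ∀ ν, ∀ᵐ ω ∂(changeLaw f₀ f₁ ν), ∀ t : ℕ, ∃ R : ℝ, |R| ≤ K ∧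
      ∑ i ∈ Finset.range (t + 1), llRatio f₀ f₁ (ν + i) ω =
        ((J * t + transitionSum
          (fun y y' => Real.log (Q₁ y y' / Q₀ y y').toReal - J + h y' - h y) ν t ω + R : ℝ) :
            EReal) := by
  obtain ⟨K₁, hK₁⟩ := exists_abs_le_of_finite fun y => Real.log (f₁.init y / f₀.init y).toReal
  obtain ⟨K₂, hK₂⟩ := exists_abs_le_of_finite fun p : 𝒴 × 𝒴 =>
    Real.log (Q₁ p.1 p.2 / Q₀ p.1 p.2).toReal
  obtain ⟨K₃, hK₃⟩ := exists_abs_le_of_finite h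
  refine ⟨max K₁ K₂ + 2 * K₃, fun ν => ?_⟩
  filter_upwards [(switch f₀ f₁ ν).ae_density_ne_zero] with ω hω t
  have hω₁ (k : ℕ) (hk : ν ≤ k) : f₁.density k ω ≠ 0 := by
    rw [← density_switch f₀ f₁ hk]
    exact hω k
  have hω₀ (k : ℕ) (hk : ν ≤ k) : f₀.density k ω ≠ 0 := by
    have h1 := hω₁ k hk
    cases k with
    | zero => exact hinit _ h1
    | succ n =>
      rw [hf₁.density_succ] at h1
      rw [hf₀.density_succ]
      exact hQ _ _ h1
  let z (k : ℕ) : ℝ := Real.log (f₁.density k ω / f₀.density k ω).toReal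
  have hz (k : ℕ) (hk : ν ≤ k) : llRatio f₀ f₁ k ω = (z k : EReal) := by
    have hd (f : ObsLaw 𝒴) : f.density k ω ≠ ∞ := by cases k <;> exact PMF.apply_ne_top _ _
    exact ENNReal.log_pos_real (ENNReal.div_ne_zero.2 ⟨hω₁ k hk, hd f₀⟩)
      (ENNReal.div_ne_top (hd f₁) (hω₀ k hk))
  have hzsucc (k : ℕ) : z (k + 1) =
      Real.log (Q₁ (ω k) (ω (k + 1)) / Q₀ (ω k) (ω (k + 1))).toReal := by
    simp only [z, hf₀.density_succ, hf₁.density_succ]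
  have hzν : |z ν| ≤ max K₁ K₂ := by
    cases ν with
    | zero => exact (hK₁ (ω 0)).trans (le_max_left _ _)
    | succ n =>
      rw [hzsucc]
      exact (hK₂ (ω n, ω (n + 1))).trans (le_max_right _ _)
  refine ⟨z ν + h (ω ν) - h (ω (ν + t)), ?_, ?_⟩
  · have h1 := abs_le.1 hzν
    have h2 := abs_le.1 (hK₃ (ω ν))
    have h3 := abs_le.1 (hK₃ (ω (ν + t)))
    exact abs_le.2 ⟨by linarith, by linarith⟩
  · induction t with
    | zero => simp [hz ν le_rfl, transitionSum]
    | succ t ih =>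
      rw [Finset.sum_range_succ, ih, hz _ (Nat.le_add_right _ _), ← EReal.coe_add,
        EReal.coe_eq_coe_iff, ← add_assoc, hzsucc, transitionSum, transitionSum,
        Finset.sum_range_succ]
      push_cast
      ring

/-- A state that is reached with positive probability passes this on to the states that a
transition of positive probability leads to. -/
theorem law_eq_succ_ne_zero {f : ObsLaw 𝒴} {Q : 𝒴 → PMF 𝒴} (hf : f.IsMarkovFrom Q 0) {k : ℕ}
    {y y' : 𝒴} (hy : f.law {ω | ω k = y} ≠ 0) (hQ : Q y y' ≠ 0) :
    f.law {ω | ω (k + 1) = y'} ≠ 0 := by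
  classical
  intro h0
  have hmem : ∀ᵐ ω ∂f.law, ω (k + 1) ≠ y' := ae_iff.2 (by simpa using h0)
  have hg : DependsOn (fun ω : ℕ → 𝒴 => if ω k = y then (1 : ℝ≥0∞) else 0) (Set.Iic k) := by
    intro ω ω' hω
    simp only [hω k Set.self_mem_Iic]
  have h1 := lintegral_markov hf (Nat.zero_le k) hg fun _ z => if z = y' then 1 else 0
  rw [lintegral_congr_ae (g := fun _ => 0) (by filter_upwards [hmem] with ω hω; simp [hω]),
    lintegral_zero, eq_comm, lintegral_eq_zero_iff] at h1
  · refine hy (measure_mono_null (fun ω hω => ?_) (ae_iff.1 h1))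
    simp only [Set.mem_ofPred_eq] at hω ⊢
    simp [hω, hQ]
  · exact (measurable_of_dependsOn hg).mul
      ((Measurable.of_discrete (f := fun z => ∑ y, Q z y * if y = y' then 1 else 0)).comp
        (measurable_pi_apply k))

end ObsLaw

/-! ### Observations of a Markov decision process -/

namespace MDP

variable {X U : Type*}

/-- The law of the next observation after `y` under the policy `π`. -/
noncomputable def obsKernel (M : MDP X U) (π : X → PMF U) (y : X × U) : PMF (X × U) :=
  (M.P y.1 y.2).bind fun x => (π x).map (Prod.mk x)

theorem bind_map_mk_apply (p : PMF X) (π : X → PMF U) (y : X × U) :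
    (p.bind fun x => (π x).map (Prod.mk x)) y = p y.1 * π y.1 y.2 := by
  classical
  rw [PMF.bind_apply, tsum_eq_single y.1]
  · rw [PMF.map_apply, tsum_eq_single y.2]
    · simp
    · intro u hu
      rw [if_neg]
      rintro h
      exact hu (congrArg Prod.snd h).symm
  · intro x hx
    rw [PMF.map_apply]
    refine mul_eq_zero_of_right _ (ENNReal.tsum_eq_zero.2 fun u => if_neg ?_)
    rintro h
    exact hx (congrArg Prod.fst h).symm

theorem obsKernel_apply (M : MDP X U) (π : X → PMF U) (y y' : X × U) :
    M.obsKernel π y y' = M.P y.1 y.2 y'.1 * π y'.1 y'.2 :=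
  bind_map_mk_apply _ _ _

theorem fullObs_init_apply (M : MDP X U) (π : X → PMF U) (ρ : PMF X) (y : X × U) :
    (M.fullObs π ρ).init y = ρ y.1 * π y.1 y.2 :=
  bind_map_mk_apply _ _ _

theorem isMarkovFrom_fullObs (M : MDP X U) (π : X → PMF U) (ρ : PMF X) :
    (M.fullObs π ρ).IsMarkovFrom (M.obsKernel π) 0 :=
  fun _ _ _ => rfl

theorem transition_pos_iff (M : MDP X U) (π : X → PMF U) (x x' : X) :
    0 < M.transition π x x' ↔ ∃ u, π x u ≠ 0 ∧ M.P x u x' ≠ 0 := by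
  rw [transition, Matrix.of_apply, ENNReal.toReal_pos_iff, and_iff_left (PMF.apply_lt_top _ _),
    pos_iff_ne_zero, chain, ← PMF.mem_support_iff, PMF.mem_support_bind_iff]
  simp [PMF.mem_support_iff]

/-- A stationary distribution of an irreducible chain charges every state. -/
theorem IsStationary.apply_ne_zero {M : MDP X U} {π : X → PMF U} {μ : PMF X}
    (hμ : M.IsStationary π μ) (hirr : (M.transition π).IsIrreducible) (x : X) : μ x ≠ 0 := by
  refine hirr.mem_of_closed (S := μ.support) μ.support_nonempty (fun x hx y hxy => ?_) x
  obtain ⟨u, hu, hy⟩ := (M.transition_pos_iff π x y).1 hxy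
  rw [← show μ.bind (M.chain π) = μ from hμ, PMF.mem_support_bind_iff]
  exact ⟨x, hx, (PMF.mem_support_bind_iff _ _ _).2 ⟨u, hu, hy⟩⟩

section Fintype

variable [Fintype X] [Fintype U]

theorem transition_apply {X : Type*} (M : MDP X U) (π : X → PMF U) (x x' : X) :
    M.transition π x x' = ∑ u, (π x u).toReal * (M.P x u x').toReal := by
  rw [transition, Matrix.of_apply, chain, PMF.bind_apply, tsum_fintype,
    ENNReal.toReal_sum fun u _ => ENNReal.mul_ne_top (PMF.apply_ne_top _ _) (PMF.apply_ne_top _ _)]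
  simp only [ENNReal.toReal_mul]

theorem IsStationary.sum_mul_transition {U : Type*} {M : MDP X U} {π : X → PMF U} {μ : PMF X}
    (hμ : M.IsStationary π μ) (y : X) :
    ∑ x, (μ x).toReal * M.transition π x y = (μ y).toReal := by
  conv_rhs => rw [← show μ.bind (M.chain π) = μ from hμ, PMF.bind_apply, tsum_fintype,
    ENNReal.toReal_sum fun u _ => ENNReal.mul_ne_top (PMF.apply_ne_top _ _) (PMF.apply_ne_top _ _)]
  simp only [ENNReal.toReal_mul]
  rfl

/-- Averages over the next observation are iterated averages over state and action. -/
theorem sum_obsKernel (M : MDP X U) (π : X → PMF U) (y : X × U) (φ : X × U → ℝ) :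
    ∑ y', (M.obsKernel π y y').toReal * φ y' =
      ∑ x, (M.P y.1 y.2 x).toReal * ∑ u, (π x u).toReal * φ (x, u) := by
  rw [Fintype.sum_prod_type]
  simp only [obsKernel_apply, ENNReal.toReal_mul, Finset.mul_sum, mul_assoc]

end Fintype

section Information

variable [Fintype X] [Fintype U] {M₀ M₁ : MDP X U} {π₀ π₁ : X → PMF U}

/-- The chain rule for the relative entropy of one observation. -/
theorem sum_obsKernel_mul_log (hP : ∀ x u x', M₁.P x u x' ≠ 0 → M₀.P x u x' ≠ 0)
    (hπ : ∀ x u, π₁ x u ≠ 0 → π₀ x u ≠ 0) (y : X × U) :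
    ∑ y', (M₁.obsKernel π₁ y y').toReal *
        Real.log (M₁.obsKernel π₁ y y' / M₀.obsKernel π₀ y y').toReal =
      ∑ x, (M₁.P y.1 y.2 x).toReal * Real.log (M₁.P y.1 y.2 x / M₀.P y.1 y.2 x).toReal +
      ∑ x, (M₁.P y.1 y.2 x).toReal *
        ∑ u, (π₁ x u).toReal * Real.log (π₁ x u / π₀ x u).toReal := by
  have hlog (y' : X × U) : (M₁.obsKernel π₁ y y').toReal *
      Real.log (M₁.obsKernel π₁ y y' / M₀.obsKernel π₀ y y').toReal =
      (M₁.obsKernel π₁ y y').toReal *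
        (Real.log (M₁.P y.1 y.2 y'.1 / M₀.P y.1 y.2 y'.1).toReal +
          Real.log (π₁ y'.1 y'.2 / π₀ y'.1 y'.2).toReal) := by
    by_cases h1 : M₁.P y.1 y.2 y'.1 = 0
    · simp [obsKernel_apply, h1]
    by_cases h2 : π₁ y'.1 y'.2 = 0
    · simp [obsKernel_apply, h2]
    simp only [obsKernel_apply, ENNReal.toReal_div, ENNReal.toReal_mul]
    rw [mul_div_mul_comm, Real.log_mul
      (div_ne_zero (ENNReal.toReal_ne_zero.2 ⟨h1, PMF.apply_ne_top _ _⟩)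
        (ENNReal.toReal_ne_zero.2 ⟨hP _ _ _ h1, PMF.apply_ne_top _ _⟩))
      (div_ne_zero (ENNReal.toReal_ne_zero.2 ⟨h2, PMF.apply_ne_top _ _⟩)
        (ENNReal.toReal_ne_zero.2 ⟨hπ _ _ h2, PMF.apply_ne_top _ _⟩))]
  simp only [hlog]
  rw [M₁.sum_obsKernel π₁ y fun y' => Real.log (M₁.P y.1 y.2 y'.1 / M₀.P y.1 y.2 y'.1).toReal +
          Real.log (π₁ y'.1 y'.2 / π₀ y'.1 y'.2).toReal, ← Finset.sum_add_distrib]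
  refine Finset.sum_congr rfl fun x _ => ?_
  simp only [mul_add, Finset.sum_add_distrib, ← Finset.sum_mul, PMF.sum_toReal, one_mul]

/-- The Poisson equation of the observation chain, reduced to the one of the state chain. -/
theorem exists_poisson_obsKernel {M : MDP X U} {π : X → PMF U} {μ : PMF X}
    (hirr : (M.transition π).IsIrreducible) (hμ : M.IsStationary π μ) (g : X × U → ℝ) :
    ∃ h : X × U → ℝ, ∀ y, h y = g y -
        ∑ x, (μ x).toReal * ∑ u, (π x u).toReal * g (x, u) +
      ∑ y', (M.obsKernel π y y').toReal * h y' := by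
  set J := ∑ x, (μ x).toReal * ∑ u, (π x u).toReal * g (x, u) with hJ
  have hrow (x : X) : ∑ y, M.transition π x y = 1 := PMF.sum_toReal (M.chain π x)
  obtain ⟨k, hk⟩ := hirr.exists_poisson hrow μ.sum_toReal hμ.sum_mul_transition
    (a := fun x => ∑ u, (π x u).toReal * g (x, u) - J) (by
      simp only [mul_sub, Finset.sum_sub_distrib, ← Finset.sum_mul, μ.sum_toReal, one_mul, ← hJ,
        sub_self])
  refine ⟨fun y => g y - J + ∑ x, (M.P y.1 y.2 x).toReal * k x, fun y => ?_⟩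
  have hmean (x : X) : ∑ u, (π x u).toReal * (g (x, u) - J + ∑ x', (M.P x u x').toReal * k x') =
      k x := by
    rw [hk x]
    simp only [mul_add, mul_sub, Finset.sum_add_distrib, Finset.sum_sub_distrib, ← Finset.sum_mul,
      PMF.sum_toReal, one_mul, transition_apply]
    congr 1
    simp only [Finset.sum_mul, Finset.mul_sum, mul_assoc]
    exact Finset.sum_comm
  rw [sum_obsKernel]
  simp only [hmean]

variable [MeasurableSpace X] [MeasurableSingletonClass X]
  [MeasurableSpace U] [MeasurableSingletonClass U] {μ₁ : PMF X}

theorem fullInfo_ne_top (hP : ∀ x u, (M₁.P x u).toMeasure ≪ (M₀.P x u).toMeasure)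
    (hπ : ∀ x, (π₁ x).toMeasure ≪ (π₀ x).toMeasure) : fullInfo M₀ M₁ π₀ π₁ μ₁ ≠ ∞ := by
  refine ENNReal.add_ne_top.2 ⟨ENNReal.sum_ne_top.2 fun x _ => ?_,
    ENNReal.sum_ne_top.2 fun x _ => ?_⟩
  · exact ENNReal.mul_ne_top (PMF.apply_ne_top _ _) (ENNReal.sum_ne_top.2 fun u _ =>
      ENNReal.mul_ne_top (PMF.apply_ne_top _ _) (PMF.klDiv_toMeasure_ne_top (hP x u)))
  · exact ENNReal.mul_ne_top (PMF.apply_ne_top _ _) (PMF.klDiv_toMeasure_ne_top (hπ x))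

/-- `fullInfo` is the stationary mean of the relative entropy of the next observation. -/
theorem toReal_fullInfo (hμ₁ : M₁.IsStationary π₁ μ₁)
    (hP : ∀ x u, (M₁.P x u).toMeasure ≪ (M₀.P x u).toMeasure)
    (hπ : ∀ x, (π₁ x).toMeasure ≪ (π₀ x).toMeasure) :
    (fullInfo M₀ M₁ π₀ π₁ μ₁).toReal =
      ∑ x, (μ₁ x).toReal * ∑ u, (π₁ x u).toReal * ∑ y',
        (M₁.obsKernel π₁ (x, u) y').toReal *
          Real.log (M₁.obsKernel π₁ (x, u) y' / M₀.obsKernel π₀ (x, u) y').toReal := by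
  have h1 (x : X) (u : U) := PMF.klDiv_toMeasure_ne_top (hP x u)
  have h2 (x : X) := PMF.klDiv_toMeasure_ne_top (hπ x)
  have h3 (x : X) (u : U) := ENNReal.mul_ne_top ((π₁ x).apply_ne_top u) (h1 x u)
  have h4 (x : X) := ENNReal.mul_ne_top (μ₁.apply_ne_top x) (ENNReal.sum_ne_top.2
    fun u (_ : u ∈ Finset.univ) => h3 x u)
  have h5 (x : X) := ENNReal.mul_ne_top (μ₁.apply_ne_top x) (h2 x)
  simp only [sum_obsKernel_mul_log
    (fun x u => (PMF.toMeasure_absolutelyContinuous_iff _ _).1 (hP x u))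
    fun x => (PMF.toMeasure_absolutelyContinuous_iff _ _).1 (hπ x)]
  rw [fullInfo, ENNReal.toReal_add (ENNReal.sum_ne_top.2 fun x _ => h4 x)
    (ENNReal.sum_ne_top.2 fun x _ => h5 x), ENNReal.toReal_sum fun x _ => h4 x,
    ENNReal.toReal_sum fun x _ => h5 x]
  simp only [ENNReal.toReal_mul, ENNReal.toReal_sum fun u _ => h3 _ u,
    PMF.toReal_klDiv_toMeasure (hP _ _), PMF.toReal_klDiv_toMeasure (hπ _), mul_add,
    Finset.sum_add_distrib]
  congr 1
  -- stationarity: the state after a stationary state is stationary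
  set k : X → ℝ := fun x => ∑ u, (π₁ x u).toReal * Real.log (π₁ x u / π₀ x u).toReal
  change ∑ x, (μ₁ x).toReal * k x =
    ∑ x, (μ₁ x).toReal * ∑ u, (π₁ x u).toReal * ∑ x', (M₁.P x u x').toReal * k x'
  calc ∑ x, (μ₁ x).toReal * k x
      = ∑ x', (∑ x, (μ₁ x).toReal * M₁.transition π₁ x x') * k x' := by
        simp only [hμ₁.sum_mul_transition]
    _ = ∑ x, (μ₁ x).toReal * ∑ x', M₁.transition π₁ x x' * k x' := by
        simp only [Finset.sum_mul, Finset.mul_sum, mul_assoc]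
        exact Finset.sum_comm
    _ = _ := by
        refine Finset.sum_congr rfl fun x _ => ?_
        congr 1
        simp only [transition_apply, Finset.sum_mul, Finset.mul_sum, mul_assoc]
        exact Finset.sum_comm

/-- The information is nonzero unless the change is void, as relative entropy separates laws. -/
theorem fullInfo_ne_zero
    (h : ∃ x ∈ μ₁.support, π₁ x ≠ π₀ x ∨ ∃ u ∈ (π₁ x).support, M₁.P x u ≠ M₀.P x u) :
    fullInfo M₀ M₁ π₀ π₁ μ₁ ≠ 0 := by
  intro h0
  obtain ⟨x, hx, hne⟩ := h
  rw [fullInfo, add_eq_zero, Finset.sum_eq_zero_iff, Finset.sum_eq_zero_iff] at h0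
  have h1 := (mul_eq_zero.1 (h0.1 x (Finset.mem_univ x))).resolve_left hx
  have h2 := (mul_eq_zero.1 (h0.2 x (Finset.mem_univ x))).resolve_left hx
  rcases hne with hne | ⟨u, hu, hne⟩
  · exact hne (PMF.toMeasure_injective (InformationTheory.klDiv_eq_zero_iff.1 h2))
  · have h3 := (mul_eq_zero.1 (Finset.sum_eq_zero_iff.1 h1 u (Finset.mem_univ u))).resolve_left hu
    exact hne (PMF.toMeasure_injective (InformationTheory.klDiv_eq_zero_iff.1 h3))

/-- In an ergodic MDP every state-action pair that the policy allows is eventually observed with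
positive probability. -/
theorem exists_law_eq_ne_zero {M : MDP X U} {π : X → PMF U}
    (hirr : (M.transition π).IsIrreducible) (ρ : PMF X) (y : X × U) (hy : π y.1 y.2 ≠ 0) :
    ∃ k, (M.fullObs π ρ).law {ω | ω k = y} ≠ 0 := by
  refine hirr.mem_of_closed (S := {x | ∀ u, π x u ≠ 0 → ∃ k, (M.fullObs π ρ).law
    {ω | ω k = (x, u)} ≠ 0}) ?_ (fun x hx x' hxx' u' hu' => ?_) y.1 y.2 hy
  · obtain ⟨x, hx⟩ := ρ.support_nonempty
    refine ⟨x, fun u hu => ⟨0, ?_⟩⟩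
    have h := Measure.map_apply (μ := (M.fullObs π ρ).law) (measurable_pi_apply 0)
      (measurableSet_singleton (x, u))
    rw [ObsLaw.law_map_zero, PMF.toMeasure_apply_singleton _ _ (measurableSet_singleton _),
      fullObs_init_apply] at h
    exact h.symm.trans_ne (mul_ne_zero hx hu)
  · obtain ⟨u, hu, hP⟩ := (M.transition_pos_iff π x x').1 hxx'
    obtain ⟨k, hk⟩ := hx u hu
    refine ⟨k + 1, ObsLaw.law_eq_succ_ne_zero (M.isMarkovFrom_fullObs π ρ) hk ?_⟩
    rw [obsKernel_apply]
    exact mul_ne_zero hP hu'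

end Information

end MDP

/-! ### Inverse privacy level with full information -/

theorem theorem1 {X U : Type*} [Fintype X] [Fintype U]
    [MeasurableSpace X] [MeasurableSingletonClass X]
    [MeasurableSpace U] [MeasurableSingletonClass U]
    (M₀ M₁ : MDP X U) (hM₀ : M₀.IsErgodic) (hM₁ : M₁.IsErgodic)
    (hP : ∀ x u, (M₁.P x u).toMeasure ≪ (M₀.P x u).toMeasure)
    (π₀ π₁ : X → PMF U) (μ₀ μ₁ : PMF X)
    (hμ₀ : M₀.IsStationary π₀ μ₀) (hμ₁ : M₁.IsStationary π₁ μ₁)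
    (ρ : PMF X) :
    ((∀ x ∈ μ₁.support, (π₁ x).toMeasure ≪ (π₀ x).toMeasure) →
      MDP.fullInfo M₀ M₁ π₀ π₁ μ₁ ≠ ∞ ∧
      ObsLaw.AverageConverges (M₀.fullObs π₀ μ₀) (M₁.fullObs π₁ ρ)
        (MDP.fullInfo M₀ M₁ π₀ π₁ μ₁).toReal ∧
      -- the change is not void (if it is, the log-likelihood ratios after the change are zero,
      -- and with zero information the overshoot event has probability one)
      ((∃ x ∈ μ₁.support, π₁ x ≠ π₀ x ∨ ∃ u ∈ (π₁ x).support, M₁.P x u ≠ M₀.P x u) →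
        ObsLaw.LaiAssumption (M₀.fullObs π₀ μ₀) (M₁.fullObs π₁ ρ)
          (MDP.fullInfo M₀ M₁ π₀ π₁ μ₁).toReal ∧
        MDP.invPrivacyFull M₀ M₁ π₀ π₁ μ₀ ρ = (MDP.fullInfo M₀ M₁ π₀ π₁ μ₁ : EReal))) ∧
    ((∃ x ∈ μ₁.support, ¬ (π₁ x).toMeasure ≪ (π₀ x).toMeasure) →
      (¬ ∃ I : ℝ, ObsLaw.LaiAssumption (M₀.fullObs π₀ μ₀) (M₁.fullObs π₁ ρ) I) ∧
      MDP.invPrivacyFull M₀ M₁ π₀ π₁ μ₀ ρ = ⊤) := by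
  refine ⟨fun hπ => ?_, fun ⟨x, _, hx⟩ => ?_⟩
  · have hπ' (x : X) : (π₁ x).toMeasure ≪ (π₀ x).toMeasure :=
      hπ x (hμ₁.apply_ne_zero (hM₁ π₁) x)
    have hP0 (x : X) (u : U) := (PMF.toMeasure_absolutelyContinuous_iff _ _).1 (hP x u)
    have hπ0 (x : X) := (PMF.toMeasure_absolutelyContinuous_iff _ _).1 (hπ' x)
    have hinit (y : X × U) : (M₁.fullObs π₁ ρ).init y ≠ 0 → (M₀.fullObs π₀ μ₀).init y ≠ 0 := by
      rw [MDP.fullObs_init_apply, MDP.fullObs_init_apply]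
      exact fun h => mul_ne_zero (hμ₀.apply_ne_zero (hM₀ π₀) y.1)
        (hπ0 y.1 y.2 (right_ne_zero_of_mul h))
    have hQ (y y' : X × U) : M₁.obsKernel π₁ y y' ≠ 0 → M₀.obsKernel π₀ y y' ≠ 0 := by
      rw [MDP.obsKernel_apply, MDP.obsKernel_apply]
      exact fun h => mul_ne_zero (hP0 _ _ _ (left_ne_zero_of_mul h))
        (hπ0 _ _ (right_ne_zero_of_mul h))
    have hfin := MDP.fullInfo_ne_top (μ₁ := μ₁) hP hπ'
    obtain ⟨h, hh⟩ := MDP.exists_poisson_obsKernel (hM₁ π₁) hμ₁ fun y => ∑ y',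
      (M₁.obsKernel π₁ y y').toReal *
        Real.log (M₁.obsKernel π₁ y y' / M₀.obsKernel π₀ y y').toReal
    rw [← MDP.toReal_fullInfo hμ₁ hP hπ'] at hh
    set J := (MDP.fullInfo M₀ M₁ π₀ π₁ μ₁).toReal 
    obtain ⟨K, hdec⟩ := ObsLaw.exists_decomposition (M₀.isMarkovFrom_fullObs π₀ μ₀)
      (M₁.isMarkovFrom_fullObs π₁ ρ) hinit hQ J h
    have hW0 (y : X × U) : ∑ y', (M₁.obsKernel π₁ y y').toReal *
        (Real.log (M₁.obsKernel π₁ y y' / M₀.obsKernel π₀ y y').toReal - J + h y' - h y) = 0 := by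
      simp only [mul_add, mul_sub, Finset.sum_add_distrib, Finset.sum_sub_distrib,
        ← Finset.sum_mul, PMF.sum_toReal, one_mul]
      linarith [hh y]
    refine ⟨hfin, ObsLaw.averageConverges_of_decomposition (M₁.isMarkovFrom_fullObs π₁ ρ) hW0 hdec,
      fun hne => ?_⟩
    have hlai := ObsLaw.laiAssumption_of_decomposition (M₁.isMarkovFrom_fullObs π₁ ρ)
      (ENNReal.toReal_pos (MDP.fullInfo_ne_zero hne) hfin) hW0 hdec
    refine ⟨hlai, ?_⟩
    rw [MDP.invPrivacyFull, ObsLaw.invPrivacy_eq_of_laiAssumption hlai,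
      EReal.coe_ennreal_toReal hfin]
  · have hno : ¬ ∃ I : ℝ, ObsLaw.LaiAssumption (M₀.fullObs π₀ μ₀) (M₁.fullObs π₁ ρ) I := by
      rintro ⟨I, hI, -⟩
      rw [PMF.toMeasure_absolutelyContinuous_iff] at hx
      push Not at hx
      obtain ⟨u, hu₁, hu₀⟩ := hx
      obtain ⟨k, hk⟩ := MDP.exists_law_eq_ne_zero (hM₁ π₁) ρ (x, u) hu₁
      refine ObsLaw.not_averageConverges_of_density_eq_zero ⟨k, ?_⟩ I hI
      have hsw : ObsLaw.switch (M₀.fullObs π₀ μ₀) (M₁.fullObs π₁ ρ) 0 = M₁.fullObs π₁ ρ := by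
        simp [ObsLaw.switch]
      rw [ObsLaw.changeLaw, hsw]
      refine (frequently_ae_iff.2 hk).mono fun ω hω => ?_
      cases k with
      | zero => rw [ObsLaw.density, hω, MDP.fullObs_init_apply, hu₀, mul_zero]
      | succ n =>
        rw [(M₀.isMarkovFrom_fullObs π₀ μ₀).density_succ, hω, MDP.obsKernel_apply, hu₀, mul_zero]
    exact ⟨hno, dif_neg hno⟩
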